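/- Let $n\ge 0$, let $p$ be a probability distribution on $\{0,1\}^{2n}$, and let $$R_p(\rho)=\sum_{(a,b)\in\{0,1\}^{2n}}p(a,b)\,X^aZ^b\,\rho\,Z^bX^a$$ be the associated Pauli-mixing map on $n$ qubits, where $X^a=X^{a_1}\otimes\cdots\otimes X^{a_n}$ and $Z^b=Z^{b_1}\otimes\cdots\otimes Z^{b_n}$ with $X,Z$ the single-qubit Pauli matrices. Let $\epsilon\ge 0$ and suppose that $R_p$ is $\epsilon$-randomizing with respect to the trace norm, i.e. $\|R_p(\rho)-\mathbb I/2^n\|_{1}\le\epsilon$ for every density operator $\rho$ on $(\mathbb C^2)^{\otimes n}$, where $\|M\|_1=\mathrm{Tr}\sqrt{M^\dagger M}$. Then $p$ is $\epsilon$-biased: for every non-zero $u\in\{0,1\}^{2n}$, $$\Bigl|\sum_{x\in\{0,1\}^{2n}}p(x)\,(-1)^{\sum_i u_ix_i}\Bigr|\le\epsilon .$$ Moreover, there is a universal constant $c>0$ (independent of $n$, $p$, $\epsilon$) such that, under the same hypotheses, the support $S=\{x: p(x)>0\}$ of $p$ satisfies $$|S|\;\ge\; c\,\min\Bigl\{2^{2n},\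 \frac{n}{\epsilon^2\log_2(1/\epsilon)}\Bigr\}\qquad\text{if } 0<\epsilon\le\tfrac12,$$ $|S|\ge c\,2^{2n}$ if $\epsilon=0$, and $$|S|\;\ge\; c\,(1-\epsilon)\min\Bigl\{2^{2n},\ \frac{n}{\epsilon^2\log_2(1/\epsilon)}\Bigr\}\qquad\text{if } \tfrac12<\epsilon<1 .$$ -/

import Mathlib

open scoped Matrix MatrixOrder ComplexOrder

noncomputable section

namespace PauliRandomization

/-- Trace norm `‖M‖₁ = Tr √(M† M)` (the trace is a nonnegative real; we take its real part). -/
def traceNorm {d : Type*} [Fintype d] [DecidableEq d] (M : Matrix d d ℂ) : ℝ :=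
  (CFC.sqrt (Mᴴ * M)).trace.re

/-- Density operators (mixed states) on `ℂ^d`. -/
def IsDensity {d : Type*} [Fintype d] (ρ : Matrix d d ℂ) : Prop :=
  ρ.PosSemidef ∧ ρ.trace = 1

/-- The linear map `R` is `ε`-randomizing with respect to the trace norm:
`‖R(ρ) - I/d‖₁ ≤ ε` for every density operator `ρ`. (The notion is meant for completely positive
trace-preserving `R`; it is applied only to the maps `pauliMap p` below, which are of this kind,
being given in Kraus form as convex combinations of unitary conjugations.) -/
def IsRandomizing {d : Type*} [Fintype d] [DecidableEq d] (ε : ℝ)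
    (R : Matrix d d ℂ →ₗ[ℂ] Matrix d d ℂ) : Prop :=
  ∀ ρ : Matrix d d ℂ, IsDensity ρ → traceNorm (R ρ - ((Fintype.card d : ℂ)⁻¹) • 1) ≤ ε

/-- The space of linear operators on `n` qubits, in the computational basis `{0,1}^n`. -/
abbrev QubitOp (n : ℕ) : Type := Matrix (Fin n → Fin 2) (Fin n → Fin 2) ℂ

/-- The tensor product `P₁ ⊗ ⋯ ⊗ Pₙ` of single-qubit operators. -/
def tensor {n : ℕ} (P : Fin n → Matrix (Fin 2) (Fin 2) ℂ) : QubitOp n :=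
  Matrix.of fun x y => ∏ j, P j (x j) (y j)

/-- The single-qubit Pauli operator `X`. -/
def pauliX : Matrix (Fin 2) (Fin 2) ℂ := !![0, 1; 1, 0]

/-- The single-qubit Pauli operator `Z`. -/
def pauliZ : Matrix (Fin 2) (Fin 2) ℂ := !![1, 0; 0, -1]

/-- `X^a = X^{a₁} ⊗ ⋯ ⊗ X^{aₙ}`. -/
def pauliXPow {n : ℕ} (a : Fin n → ZMod 2) : QubitOp n := tensor fun j => pauliX ^ (a j).val

/-- `Z^b = Z^{b₁} ⊗ ⋯ ⊗ Z^{bₙ}`. -/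
def pauliZPow {n : ℕ} (b : Fin n → ZMod 2) : QubitOp n := tensor fun j => pauliZ ^ (b j).val

/-- `{0,1}^{2n}`: the string `w = (a, b)` has `a = w ∘ Sum.inl` and `b = w ∘ Sum.inr`. -/
abbrev PauliString (n : ℕ) : Type := Fin n ⊕ Fin n → ZMod 2

/-- The map `R_p(ρ) = ∑_{(a,b)} p(a,b) X^a Z^b ρ Z^b X^a`. -/
def pauliMap {n : ℕ} (p : PMF (PauliString n)) : QubitOp n →ₗ[ℂ] QubitOp n where
  toFun ρ := ∑ w : PauliString n, ((p w).toReal : ℂ) •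
    (pauliXPow (w ∘ Sum.inl) * pauliZPow (w ∘ Sum.inr) * ρ *
      pauliZPow (w ∘ Sum.inr) * pauliXPow (w ∘ Sum.inl))
  map_add' ρ σ := by
    simp only [Matrix.mul_add, Matrix.add_mul, smul_add, Finset.sum_add_distrib]
  map_smul' c ρ := by
    simp only [Matrix.mul_smul, Matrix.smul_mul, RingHom.id_apply, Finset.smul_sum]
    exact Finset.sum_congr rfl fun w _ => smul_comm _ _ _

/-- `bias(p, u) = |E (-1)^{⟨u, X⟩}|` for `X` distributed according to `p`,
where `⟨u, x⟩ = ∑ᵢ uᵢ xᵢ (mod 2)`. -/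
def bias {ι : Type*} [Fintype ι] [DecidableEq ι] (p : PMF (ι → ZMod 2)) (u : ι → ZMod 2) : ℝ :=
  |∑ x : ι → ZMod 2, (p x).toReal * (-1) ^ (u ⬝ᵥ x).val|

/-- `p` is `δ`-biased if its bias with respect to every nonzero string is at most `δ`. -/
def IsBiased {ι : Type*} [Fintype ι] [DecidableEq ι] (δ : ℝ) (p : PMF (ι → ZMod 2)) : Prop :=
  ∀ u : ι → ZMod 2, u ≠ 0 → bias p u ≤ δ

end PauliRandomization

end

namespace PauliRandomization

/-! Conjugation by a Pauli operator changes any other Pauli operator only by a sign, so each `X^α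
Z^β` is an eigenvector of `pauliMap p`, with eigenvalue a Fourier coefficient of `p`. If `P` is a
nontrivial Pauli rescaled to a Hermitian involution, then `(1 + P)/2^n` is a state whose image
differs from `1/2^n` by that coefficient times `P/2^n`, of trace norm the bias. Hence randomizing
implies small bias.

For the support, the sum of `k` independent samples has Fourier coefficients at most `ε^k` and lives
on at most `(|S|+k-1).choose k` points. Parseval and Cauchy–Schwarz give `choose_mul_pow_ge`; for `ε
≤ 1/4`, taking `k` near `n / log₂(1/ε)` yields the bound. For `1/4 < ε < 1` it is enough that `S`
spans, so that `|S| ≥ 2n`. -/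

/-- The nontrivial additive character `t ↦ (-1)^t` of `ZMod 2`, with real values. -/
def signChar (t : ZMod 2) : ℝ := (-1) ^ t.val

@[simp] lemma signChar_zero : signChar 0 = 1 := by simp [signChar]

@[simp] lemma signChar_one : signChar 1 = -1 := by
  simp [signChar, ZMod.val_one]

lemma zmod_two_eq_zero_or_one : ∀ t : ZMod 2, t = 0 ∨ t = 1 := by decide

lemma signChar_add (s t : ZMod 2) : signChar (s + t) = signChar s * signChar t := by
  have h2 : (1 + 1 : ZMod 2) = 0 := by decide
  obtain rfl | rfl := zmod_two_eq_zero_or_one s <;>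
    obtain rfl | rfl := zmod_two_eq_zero_or_one t <;> simp [h2]

lemma signChar_sum {α : Type*} (s : Finset α) (f : α → ZMod 2) :
    signChar (∑ i ∈ s, f i) = ∏ i ∈ s, signChar (f i) := by
  classical
  induction s using Finset.induction_on with
  | empty => simp
  | insert a s ha ih => rw [Finset.sum_insert ha, Finset.prod_insert ha, signChar_add, ih]

lemma signChar_mul_self (t : ZMod 2) : signChar t * signChar t = 1 := by
  obtain rfl | rfl := zmod_two_eq_zero_or_one t <;> simp

/-! ### Fourier analysis on `(ZMod 2)^ι` and supports of small-bias distributions -/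

section Fourier

variable {ι : Type*} [Fintype ι] [DecidableEq ι]

lemma sum_signChar_dotProduct {y : ι → ZMod 2} (hy : y ≠ 0) :
    ∑ u : ι → ZMod 2, signChar (u ⬝ᵥ y) = 0 := by
  obtain ⟨i, hi⟩ := Function.ne_iff.mp hy
  have hi1 : y i = 1 := (zmod_two_eq_zero_or_one _).resolve_left hi
  -- Translating `u` by the `i`-th basis vector flips every sign, so the sum equals its own
  -- negative.
  have h := Equiv.sum_comp (Equiv.addRight (Pi.single i (1 : ZMod 2)))
    (fun u : ι → ZMod 2 => signChar (u ⬝ᵥ y))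
  have h1 : ∀ u : ι → ZMod 2, signChar (Equiv.addRight (Pi.single i (1 : ZMod 2)) u ⬝ᵥ y) =
      -signChar (u ⬝ᵥ y) := fun u => by
    rw [Equiv.coe_addRight, add_dotProduct, signChar_add, single_dotProduct, hi1, one_mul,
      signChar_one, mul_neg_one]
  rw [Finset.sum_congr rfl fun u _ => h1 u, Finset.sum_neg_distrib] at h
  exact self_eq_neg.mp h.symm

/-- Orthogonality of the characters of `(ZMod 2)^ι`. -/
lemma sum_signChar_mul_signChar (y z : ι → ZMod 2) :
    ∑ u : ι → ZMod 2, signChar (u ⬝ᵥ y) * signChar (u ⬝ᵥ z) =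
      if y = z then (2 : ℝ) ^ Fintype.card ι else 0 := by
  split_ifs with h
  · subst h
    simp [signChar_mul_self, ZMod.card]
  · simp_rw [← signChar_add, ← dotProduct_add]
    apply sum_signChar_dotProduct
    intro h0
    apply h
    have : y - z = 0 := by rw [← h0]; ext i; simp [sub_eq_add_neg, ZMod.neg_eq_self_mod_two]
    exact sub_eq_zero.mp this

/-- The Fourier transform on `(ZMod 2)^ι`. -/
def fourier (q : (ι → ZMod 2) → ℝ) (u : ι → ZMod 2) : ℝ := ∑ x, q x * signChar (u ⬝ᵥ x)

lemma sum_fourier_sq (q : (ι → ZMod 2) → ℝ) :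
    ∑ u, fourier q u ^ 2 = (2 : ℝ) ^ Fintype.card ι * ∑ x, q x ^ 2 := by
  simp only [fourier, sq, Finset.sum_mul_sum]
  rw [Finset.sum_comm]
  rw [Finset.mul_sum]
  refine Finset.sum_congr rfl fun x _ => ?_
  rw [Finset.sum_comm]
  have : ∀ y, ∑ u, q x * signChar (u ⬝ᵥ x) * (q y * signChar (u ⬝ᵥ y)) =
      q x * q y * if x = y then (2 : ℝ) ^ Fintype.card ι else 0 := by
    intro y
    rw [← sum_signChar_mul_signChar, Finset.mul_sum]
    exact Finset.sum_congr rfl fun u _ => by ring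
  simp only [this, mul_ite, mul_zero, Finset.sum_ite_eq, Finset.mem_univ, if_true]
  ring

/-- If the nontrivial Fourier coefficients of a function of total mass one are at most `η`, then
the function cannot be concentrated on a small set. -/
lemma card_mul_one_add_ge {q : (ι → ZMod 2) → ℝ} {T : Finset (ι → ZMod 2)} {η : ℝ}
    (hq : ∑ x, q x = 1) (hT : ∀ x, x ∉ T → q x = 0) (hη : ∀ u, u ≠ 0 → |fourier q u| ≤ η) :
    (2 : ℝ) ^ Fintype.card ι ≤ T.card * (1 + (2 : ℝ) ^ Fintype.card ι * η ^ 2) := by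
  have hT1 : ∑ x ∈ T, q x = 1 := by
    rw [← hq]; exact Finset.sum_subset (Finset.subset_univ _) fun x _ hx => hT x hx
  -- Cauchy–Schwarz on `T` bounds the `ℓ²` mass below; Parseval with `hF` bounds it above.
  have hcs : 1 ≤ (T.card : ℝ) * ∑ x, q x ^ 2 := by
    have h1 := sq_sum_le_card_mul_sum_sq (s := T) (f := q)
    rw [hT1] at h1
    have h2 : ∑ x ∈ T, q x ^ 2 ≤ ∑ x, q x ^ 2 :=
      Finset.sum_le_sum_of_subset_of_nonneg (Finset.subset_univ _) fun _ _ _ => sq_nonneg _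
    nlinarith [Nat.cast_nonneg (α := ℝ) T.card]
  have hF : ∑ u, fourier q u ^ 2 ≤ 1 + (2 : ℝ) ^ Fintype.card ι * η ^ 2 := by
    rw [← Finset.add_sum_erase _ _ (Finset.mem_univ (0 : ι → ZMod 2))]
    have h0 : fourier q 0 = 1 := by simp [fourier, hq]
    rw [h0, one_pow]
    gcongr
    calc ∑ u ∈ Finset.univ.erase 0, fourier q u ^ 2
        ≤ ∑ u ∈ Finset.univ.erase (0 : ι → ZMod 2), η ^ 2 := by
          refine Finset.sum_le_sum fun u hu => ?_
          exact sq_le_sq.mpr ((hη u (Finset.ne_of_mem_erase hu)).trans (le_abs_self _))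
      _ ≤ ∑ u : ι → ZMod 2, η ^ 2 :=
          Finset.sum_le_sum_of_subset_of_nonneg (Finset.subset_univ _) fun _ _ _ => sq_nonneg _
      _ = _ := by simp [ZMod.card]
  rw [sum_fourier_sq] at hF
  calc (2 : ℝ) ^ Fintype.card ι ≤ (2 : ℝ) ^ Fintype.card ι * (T.card * ∑ x, q x ^ 2) :=
        le_mul_of_one_le_right (by positivity) hcs
    _ = T.card * ((2 : ℝ) ^ Fintype.card ι * ∑ x, q x ^ 2) := by ring
    _ ≤ _ := by gcongr

/-- The distribution of the sum of `k` independent samples from `p`. -/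
def iteratedConv (p : (ι → ZMod 2) → ℝ) (k : ℕ) (y : ι → ZMod 2) : ℝ :=
  ∑ f : Fin k → ι → ZMod 2 with ∑ i, f i = y, ∏ i, p (f i)

lemma fourier_iteratedConv (p : (ι → ZMod 2) → ℝ) (k : ℕ) (u : ι → ZMod 2) :
    fourier (iteratedConv p k) u = fourier p u ^ k := by
  have hpow : fourier p u ^ k = ∏ _i : Fin k, fourier p u := by simp
  rw [hpow]
  simp only [fourier, iteratedConv, Finset.prod_univ_sum, Fintype.piFinset_univ, Finset.sum_mul]
  rw [← Finset.sum_fiberwise Finset.univ (fun f : Fin k → ι → ZMod 2 => ∑ i, f i)]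
  refine Finset.sum_congr rfl fun y _ => Finset.sum_congr rfl fun f hf => ?_
  rw [Finset.prod_mul_distrib, ← signChar_sum, ← dotProduct_sum, (Finset.mem_filter.mp hf).2]

/-- The set of sums of `k` elements of `S`, with repetition. -/
def sumset (S : Finset (ι → ZMod 2)) (k : ℕ) : Finset (ι → ZMod 2) :=
  Finset.univ.image fun m : Sym S k => ((m : Multiset S).map Subtype.val).sum

-- Addition is commutative, so multisets suffice. Counting them instead of `k`-tuples saves roughly
-- `k!`, the source of the factor `n / log₂(1/ε)` in the final bound.
omit [DecidableEq ι] in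
lemma card_sumset_le (S : Finset (ι → ZMod 2)) (k : ℕ) :
    (sumset S k).card ≤ (S.card + k - 1).choose k := by
  refine Finset.card_image_le.trans ?_
  rw [Finset.card_univ, Sym.card_sym_eq_choose, Fintype.card_coe]

lemma iteratedConv_eq_zero {p : (ι → ZMod 2) → ℝ} {S : Finset (ι → ZMod 2)}
    (hS : ∀ x, x ∉ S → p x = 0) (k : ℕ) {y : ι → ZMod 2} (hy : y ∉ sumset S k) :
    iteratedConv p k y = 0 := by
  refine Finset.sum_eq_zero fun f hf => ?_
  by_contra hne
  have hfS : ∀ i, f i ∈ S := fun i => by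
    by_contra hi
    exact hne (Finset.prod_eq_zero (Finset.mem_univ i) (hS _ hi))
  apply hy
  refine Finset.mem_image.mpr ⟨⟨Finset.univ.val.map fun i : Fin k => (⟨f i, hfS i⟩ : S), by simp⟩,
    Finset.mem_univ _, ?_⟩
  rw [← (Finset.mem_filter.mp hf).2]
  simp [Finset.sum, Function.comp_def]

/-- Convolution powers damp the nontrivial coefficients to `δ^k` while the support grows only to
`sumset S k`; `k` remains free to be optimized. -/
lemma choose_mul_pow_ge {p : (ι → ZMod 2) → ℝ} {S : Finset (ι → ZMod 2)} {δ : ℝ}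
    (hp : ∑ x, p x = 1) (hS : ∀ x, x ∉ S → p x = 0) (hδ : ∀ u, u ≠ 0 → |fourier p u| ≤ δ)
    (k : ℕ) :
    (2 : ℝ) ^ Fintype.card ι ≤
      ((S.card + k - 1).choose k : ℕ) * (1 + (2 : ℝ) ^ Fintype.card ι * (δ ^ k) ^ 2) := by
  have h := card_mul_one_add_ge (q := iteratedConv p k) (T := sumset S k) (η := δ ^ k) ?_
    (fun x hx => iteratedConv_eq_zero hS k hx) ?_
  · refine h.trans ?_
    gcongr
    exact card_sumset_le S k
  · have h0 := fourier_iteratedConv p k 0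
    simpa [fourier, hp] using h0
  · intro u hu
    rw [fourier_iteratedConv, abs_pow]
    exact pow_le_pow_left₀ (abs_nonneg _) (hδ u hu) k

/-- A distribution with all nontrivial biases below `1` has support of full rank. -/
lemma card_le_of_fourier_lt_one {p : (ι → ZMod 2) → ℝ} {S : Finset (ι → ZMod 2)}
    (hp : ∑ x, p x = 1) (hS : ∀ x, x ∉ S → p x = 0) (hδ : ∀ u, u ≠ 0 → |fourier p u| < 1) :
    Fintype.card ι ≤ S.card := by
  by_contra! hlt
  let φ : (ι → ZMod 2) →ₗ[ZMod 2] (S → ZMod 2) :=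
    LinearMap.pi fun s => (dotProductBilin (ZMod 2) (ZMod 2)).flip s.1
  -- Fewer than `card ι` linear conditions leave a nonzero `u` orthogonal to all of `S`; its Fourier
  -- coefficient is then the total mass `1`.
  have hker : LinearMap.ker φ ≠ ⊥ := LinearMap.ker_ne_bot_of_finrank_lt (by simpa using hlt)
  obtain ⟨u, hu, hu0⟩ := (Submodule.ne_bot_iff _).mp hker
  have hdot : ∀ s ∈ S, u ⬝ᵥ s = 0 := fun s hs => by
    have := congrFun (LinearMap.mem_ker.mp hu) ⟨s, hs⟩
    simpa [φ] using this
  have h1 : fourier p u = 1 := by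
    rw [← hp]
    refine Finset.sum_congr rfl fun x _ => ?_
    by_cases hx : x ∈ S
    · rw [hdot x hx, signChar_zero, mul_one]
    · rw [hS x hx, zero_mul]
  have := hδ u hu0
  rw [h1] at this
  simp at this

end Fourier

/-! ### Trace norm of scaled unitaries, and states built from involutions -/

section TraceNorm

variable {d : Type*} [Fintype d] [DecidableEq d]

/-- `(cP)ᴴ(cP)` is the square of the nonnegative matrix `‖c‖ • 1`. -/
lemma traceNorm_smul_of_unitary (c : ℂ) {P : Matrix d d ℂ} (hP : Pᴴ * P = 1) :
    traceNorm (c • P) = ‖c‖ * Fintype.card d := by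
  have h1 : (c • P)ᴴ * (c • P) = ((‖c‖ : ℂ) • (1 : Matrix d d ℂ)) * ((‖c‖ : ℂ) • 1) := by
    rw [Matrix.conjTranspose_smul, Matrix.smul_mul, Matrix.mul_smul, hP, Matrix.smul_mul,
      Matrix.mul_smul, Matrix.one_mul, smul_smul, smul_smul]
    congr 1
    rw [← Complex.ofReal_mul, Complex.norm_mul_self_eq_normSq, Complex.normSq_eq_conj_mul_self]
    rfl
  have h2 : (0 : Matrix d d ℂ) ≤ (‖c‖ : ℂ) • 1 := by
    rw [Matrix.nonneg_iff_posSemidef]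
    exact Matrix.PosSemidef.one.smul (by exact_mod_cast norm_nonneg c)
  rw [traceNorm, h1, CFC.sqrt_mul_self _ h2, Matrix.trace_smul, Matrix.trace_one]
  simp

lemma isDensity_of_involution {P : Matrix d d ℂ} (hH : Pᴴ = P) (hP : P * P = 1)
    (htr : P.trace = 0) (hd : Fintype.card d ≠ 0) :
    IsDensity (((Fintype.card d : ℂ)⁻¹) • (1 + P)) := by
  refine ⟨?_, ?_⟩
  · have h : ((Fintype.card d : ℂ)⁻¹) • (1 + P) =
        ((Fintype.card d : ℂ)⁻¹ * 2⁻¹) • ((1 + P)ᴴ * (1 + P)) := by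
      -- `(1 + P)/2` is a projection, which gives positivity.
      have h2 : (1 + P)ᴴ * (1 + P) = (2 : ℂ) • (1 + P) := by
        rw [Matrix.conjTranspose_add, hH, Matrix.conjTranspose_one, mul_add, add_mul, add_mul, hP,
          two_smul]
        simp only [mul_one, one_mul]
        abel
      rw [h2, smul_smul]
      congr 1
      field_simp
    rw [h]
    refine (Matrix.posSemidef_conjTranspose_mul_self _).smul ?_
    have h0 : (0 : ℝ) ≤ (Fintype.card d : ℝ)⁻¹ * 2⁻¹ := by positivity
    simpa using Complex.zero_le_real.mpr h0
  · rw [Matrix.trace_smul, Matrix.trace_add, htr, Matrix.trace_one]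
    simp [hd]

end TraceNorm

/-! ### Pauli operators as eigenvectors of the mixing map -/

section Pauli

variable {n : ℕ}

lemma tensor_mul (P Q : Fin n → Matrix (Fin 2) (Fin 2) ℂ) :
    tensor P * tensor Q = tensor fun j => P j * Q j := by
  ext x y
  simp only [tensor, Matrix.mul_apply, Matrix.of_apply, Finset.prod_univ_sum,
    Fintype.piFinset_univ, Finset.prod_mul_distrib]

lemma tensor_smul (c : Fin n → ℂ) (P : Fin n → Matrix (Fin 2) (Fin 2) ℂ) :
    tensor (fun j => c j • P j) = (∏ j, c j) • tensor P := by
  ext x y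
  simp [tensor, Finset.prod_mul_distrib]

lemma tensor_one : tensor (fun _ : Fin n => (1 : Matrix (Fin 2) (Fin 2) ℂ)) = 1 := by
  ext x y
  simp only [tensor, Matrix.of_apply, Matrix.one_apply, Finset.prod_ite_zero]
  simp [funext_iff]

lemma conjTranspose_tensor (P : Fin n → Matrix (Fin 2) (Fin 2) ℂ) :
    (tensor P)ᴴ = tensor fun j => (P j)ᴴ := by
  ext x y
  simp [tensor, Matrix.conjTranspose_apply]

lemma trace_tensor (P : Fin n → Matrix (Fin 2) (Fin 2) ℂ) :
    (tensor P).trace = ∏ j, (P j).trace := by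
  simp only [tensor, Matrix.trace, Matrix.diag_apply, Matrix.of_apply, Finset.prod_univ_sum,
    Fintype.piFinset_univ]

/-- The single-qubit operator `X^a Z^b`. -/
def qubitWeyl (a b : ZMod 2) : Matrix (Fin 2) (Fin 2) ℂ := pauliX ^ a.val * pauliZ ^ b.val

lemma qubitWeyl_commutation (a b α β : ZMod 2) :
    qubitWeyl a b * qubitWeyl α β * (qubitWeyl a b)ᴴ =
      (signChar (β * a + α * b) : ℂ) • qubitWeyl α β := by
  have h2 : (1 + 1 : ZMod 2) = 0 := by decide
  obtain rfl | rfl := zmod_two_eq_zero_or_one a <;>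
    obtain rfl | rfl := zmod_two_eq_zero_or_one b <;>
    obtain rfl | rfl := zmod_two_eq_zero_or_one α <;>
    obtain rfl | rfl := zmod_two_eq_zero_or_one β <;>
    ext i j <;> fin_cases i <;> fin_cases j <;>
    simp [qubitWeyl, pauliX, pauliZ, ZMod.val_one, h2, Matrix.mul_apply, Fin.sum_univ_two]

lemma conjTranspose_qubitWeyl (a b : ZMod 2) :
    (qubitWeyl a b)ᴴ = (signChar (a * b) : ℂ) • qubitWeyl a b := by
  obtain rfl | rfl := zmod_two_eq_zero_or_one a <;>
    obtain rfl | rfl := zmod_two_eq_zero_or_one b <;>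
    ext i j <;> fin_cases i <;> fin_cases j <;>
    simp [qubitWeyl, pauliX, pauliZ, ZMod.val_one]

lemma conjTranspose_qubitWeyl_eq (a b : ZMod 2) :
    (qubitWeyl a b)ᴴ = pauliZ ^ b.val * pauliX ^ a.val := by
  obtain rfl | rfl := zmod_two_eq_zero_or_one a <;>
    obtain rfl | rfl := zmod_two_eq_zero_or_one b <;>
    ext i j <;> fin_cases i <;> fin_cases j <;>
    simp [qubitWeyl, pauliX, pauliZ, ZMod.val_one, Matrix.mul_apply, Fin.sum_univ_two]

lemma qubitWeyl_mul_conjTranspose (a b : ZMod 2) : qubitWeyl a b * (qubitWeyl a b)ᴴ = 1 := by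
  obtain rfl | rfl := zmod_two_eq_zero_or_one a <;>
    obtain rfl | rfl := zmod_two_eq_zero_or_one b <;>
    ext i j <;> fin_cases i <;> fin_cases j <;>
    simp [qubitWeyl, pauliX, pauliZ, ZMod.val_one, Matrix.mul_apply, Fin.sum_univ_two]

lemma trace_qubitWeyl {a b : ZMod 2} (h : a ≠ 0 ∨ b ≠ 0) : (qubitWeyl a b).trace = 0 := by
  obtain rfl | rfl := zmod_two_eq_zero_or_one a <;>
    obtain rfl | rfl := zmod_two_eq_zero_or_one b <;>
    simp_all [qubitWeyl, pauliX, pauliZ, ZMod.val_one, Matrix.trace, Fin.sum_univ_two]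

/-- The `n`-qubit operator `X^a Z^b`. -/
def weyl (a b : Fin n → ZMod 2) : QubitOp n := tensor fun j => qubitWeyl (a j) (b j)

lemma pauliXPow_mul_pauliZPow (a b : Fin n → ZMod 2) :
    pauliXPow a * pauliZPow b = weyl a b := tensor_mul _ _

lemma pauliZPow_mul_pauliXPow (a b : Fin n → ZMod 2) :
    pauliZPow b * pauliXPow a = (weyl a b)ᴴ := by
  simp only [weyl, conjTranspose_tensor, conjTranspose_qubitWeyl_eq]
  exact tensor_mul _ _

lemma weyl_mul_conjTranspose (a b : Fin n → ZMod 2) : weyl a b * (weyl a b)ᴴ = 1 := by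
  simp only [weyl, conjTranspose_tensor, tensor_mul, qubitWeyl_mul_conjTranspose, tensor_one]

/-- The sign is the symplectic pairing: `β` meets `a` and `α` meets `b`. So the character indexed by
`u` belongs to the operator with the two halves of `u` swapped. -/
lemma weyl_commutation (a b α β : Fin n → ZMod 2) :
    weyl a b * weyl α β * (weyl a b)ᴴ = (signChar (β ⬝ᵥ a + α ⬝ᵥ b) : ℂ) • weyl α β := by
  simp only [weyl, conjTranspose_tensor, tensor_mul, qubitWeyl_commutation, tensor_smul]
  rw [dotProduct, dotProduct, ← Finset.sum_add_distrib, signChar_sum, Complex.ofReal_prod]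

lemma conjTranspose_weyl (a b : Fin n → ZMod 2) :
    (weyl a b)ᴴ = (signChar (a ⬝ᵥ b) : ℂ) • weyl a b := by
  simp only [weyl, conjTranspose_tensor, conjTranspose_qubitWeyl, tensor_smul]
  rw [dotProduct, signChar_sum, Complex.ofReal_prod]

lemma trace_weyl {a b : Fin n → ZMod 2} (h : a ≠ 0 ∨ b ≠ 0) : (weyl a b).trace = 0 := by
  obtain ⟨j, hj⟩ : ∃ j, a j ≠ 0 ∨ b j ≠ 0 := by
    rcases h with h | h
    · exact (Function.ne_iff.mp h).imp fun j hj => Or.inl hj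
    · exact (Function.ne_iff.mp h).imp fun j hj => Or.inr hj
  rw [weyl, trace_tensor]
  exact Finset.prod_eq_zero (Finset.mem_univ j) (trace_qubitWeyl hj)

/-- A scalar multiple of each `X^a Z^b` is a Hermitian involution. -/
lemma exists_smul_weyl_involution (a b : Fin n → ZMod 2) :
    ∃ c : ℂ, (c • weyl a b)ᴴ = c • weyl a b ∧ (c • weyl a b) * (c • weyl a b) = 1 := by
  -- The operator is Hermitian or anti-Hermitian according to `a ⬝ᵥ b`; `c` is `1` or `i`
  -- accordingly.
  obtain ⟨c, hc1, hc2⟩ : ∃ c : ℂ, star c * signChar (a ⬝ᵥ b) = c ∧ star c * c = 1 := by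
    generalize a ⬝ᵥ b = t
    obtain rfl | rfl := zmod_two_eq_zero_or_one t
    · exact ⟨1, by simp⟩
    · exact ⟨Complex.I, by simp⟩
  have hH : (c • weyl a b)ᴴ = c • weyl a b := by
    rw [Matrix.conjTranspose_smul, conjTranspose_weyl, smul_smul, hc1]
  refine ⟨c, hH, ?_⟩
  nth_rewrite 2 [← hH]
  rw [Matrix.conjTranspose_smul, Matrix.smul_mul, Matrix.mul_smul, smul_smul,
    weyl_mul_conjTranspose, mul_comm, hc2, one_smul]

lemma sum_toReal_eq_one {α : Type*} [Fintype α] (p : PMF α) : ∑ x, (p x).toReal = 1 := by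
  rw [← ENNReal.toReal_sum fun x _ => p.apply_ne_top x, ← tsum_fintype (L := .unconditional α),
    p.tsum_coe, ENNReal.toReal_one]

lemma pauliMap_apply (p : PMF (PauliString n)) (ρ : QubitOp n) :
    pauliMap p ρ = ∑ w : PauliString n, ((p w).toReal : ℂ) •
      (weyl (w ∘ Sum.inl) (w ∘ Sum.inr) * ρ * (weyl (w ∘ Sum.inl) (w ∘ Sum.inr))ᴴ) := by
  rw [pauliMap, LinearMap.coe_mk, AddHom.coe_mk]
  refine Finset.sum_congr rfl fun w _ => ?_
  rw [← pauliZPow_mul_pauliXPow, ← pauliXPow_mul_pauliZPow, mul_assoc _ (pauliZPow _) (pauliXPow _)]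

lemma pauliMap_one (p : PMF (PauliString n)) : pauliMap p 1 = 1 := by
  simp only [pauliMap_apply, mul_one, weyl_mul_conjTranspose]
  rw [← Finset.sum_smul, ← Complex.ofReal_sum, sum_toReal_eq_one, Complex.ofReal_one, one_smul]

/-- The operators `X^α Z^β` are eigenvectors of `pauliMap p`, with the Fourier coefficients of `p`
as eigenvalues. -/
lemma pauliMap_weyl (p : PMF (PauliString n)) (u : PauliString n) :
    pauliMap p (weyl (u ∘ Sum.inr) (u ∘ Sum.inl)) =
      (fourier (fun x => (p x).toReal) u : ℂ) • weyl (u ∘ Sum.inr) (u ∘ Sum.inl) := by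
  simp only [pauliMap_apply, weyl_commutation, smul_smul, fourier, ← Finset.sum_smul,
    ← Complex.ofReal_mul, ← Complex.ofReal_sum]
  simp [dotProduct, Fintype.sum_sum_type]

theorem isBiased_of_isRandomizing (p : PMF (PauliString n)) {ε : ℝ}
    (h : IsRandomizing ε (pauliMap p)) : IsBiased ε p := by
  intro u hu
  obtain ⟨c, hH, hP⟩ := exists_smul_weyl_involution (u ∘ Sum.inr) (u ∘ Sum.inl)
  have hd : Fintype.card (Fin n → Fin 2) ≠ 0 := Fintype.card_ne_zero
  have htr : (c • weyl (u ∘ Sum.inr) (u ∘ Sum.inl)).trace = 0 := by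
    rw [Matrix.trace_smul, trace_weyl, smul_zero]
    by_contra! h0
    refine hu (funext fun i => ?_)
    rcases i with i | i
    · exact congrFun h0.2 i
    · exact congrFun h0.1 i
  have hρ := h _ (isDensity_of_involution hH hP htr hd)
  rw [map_smul, map_add, map_smul, pauliMap_one, pauliMap_weyl, smul_comm c, ← smul_sub,
    add_sub_cancel_left, smul_smul, traceNorm_smul_of_unitary _ (by rw [hH, hP])] at hρ
  have hd' : (Fintype.card (Fin n → Fin 2) : ℝ) ≠ 0 := Nat.cast_ne_zero.mpr hd
  rw [norm_mul, norm_inv, Complex.norm_natCast, Complex.norm_real, mul_comm, ← mul_assoc,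
    mul_inv_cancel₀ hd', one_mul] at hρ
  exact hρ

end Pauli

/-! ### Numerical estimates and the choice of `k` -/

lemma choose_le_exp_mul_div_pow (s : ℕ) {k : ℕ} (hk : 1 ≤ k) :
    ((s + k - 1).choose k : ℝ) ≤ (3 * (s + k) / k) ^ k := by
  have hk0 : (0 : ℝ) < k := by exact_mod_cast hk
  have h1 : ((s + k - 1).choose k : ℝ) ≤ ((s + k : ℕ) : ℝ) ^ k / k.factorial :=
    (Nat.choose_le_pow_div k (s + k - 1)).trans (by gcongr; omega)
  have h2 : (k : ℝ) ^ k / k.factorial ≤ 3 ^ k := by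
    refine (Real.pow_div_factorial_le_exp (k : ℝ) hk0.le k).trans ?_
    rw [← Real.exp_one_pow]
    exact pow_le_pow_left₀ (Real.exp_pos _).le (Real.exp_one_lt_three).le _
  calc ((s + k - 1).choose k : ℝ) ≤ ((s + k : ℕ) : ℝ) ^ k / k.factorial := h1
    _ = ((s + k : ℕ) / k : ℝ) ^ k * ((k : ℝ) ^ k / k.factorial) := by
        rw [div_pow]; field_simp
    _ ≤ ((s + k : ℕ) / k : ℝ) ^ k * 3 ^ k := by gcongr
    _ = _ := by rw [← mul_pow]; push_cast; ring

/-- By `hkε` the `1` in the last factor is absorbed at the cost of a factor `2`; the power `2^{2n}`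
then cancels and a `k`-th root can be taken. -/
lemma le_mul_of_choose_bound {n s k : ℕ} {ε : ℝ} (hε0 : 0 < ε) (hε : ε ≤ 1 / 4)
    (hk : 1 ≤ k) (hkε : 1 ≤ (2 : ℝ) ^ (2 * n) * (ε ^ k) ^ 2)
    (h : (2 : ℝ) ^ (2 * n) ≤
      ((s + k - 1).choose k : ℕ) * (1 + (2 : ℝ) ^ (2 * n) * (ε ^ k) ^ 2)) :
    (k : ℝ) ≤ 12 * ε ^ 2 * s := by
  have hk0 : (0 : ℝ) < k := by exact_mod_cast hk
  set N : ℝ := (2 : ℝ) ^ (2 * n)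
  have hN : 0 < N := by positivity
  have h1 : 1 ≤ ((s + k - 1).choose k : ℝ) * (2 * (ε ^ k) ^ 2) := by
    have : N ≤ N * (((s + k - 1).choose k : ℝ) * (2 * (ε ^ k) ^ 2)) := by
      calc N ≤ ((s + k - 1).choose k : ℝ) * (1 + N * (ε ^ k) ^ 2) := h
        _ ≤ ((s + k - 1).choose k : ℝ) * (N * (ε ^ k) ^ 2 + N * (ε ^ k) ^ 2) := by gcongr
        _ = _ := by ring
    exact le_of_mul_le_mul_left (by simpa using this) hN
  have h2 : 1 ≤ (6 * (s + k) / k * ε ^ 2 : ℝ) ^ k := by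
    calc (1 : ℝ) ≤ ((s + k - 1).choose k : ℝ) * (2 * (ε ^ k) ^ 2) := h1
      _ ≤ (3 * (s + k) / k) ^ k * (2 ^ k * (ε ^ k) ^ 2) := by
          gcongr
          · exact choose_le_exp_mul_div_pow s hk
          -- The factor `2` is weakened to `2^k` so that the whole right side is a `k`-th power.
          · exact le_self_pow₀ (by norm_num) (by omega)
      _ = _ := by rw [← pow_mul, mul_comm k 2, pow_mul, ← mul_pow, ← mul_pow]; congr 1; ring
  have h3 : 1 ≤ (6 * (s + k) / k * ε ^ 2 : ℝ) := by
    by_contra! hlt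
    exact absurd h2 (not_le.mpr (pow_lt_one₀ (by positivity) hlt (by omega)))
  have h4 : (k : ℝ) ≤ 6 * (s + k) * ε ^ 2 := by
    have := mul_le_mul_of_nonneg_right h3 hk0.le
    field_simp at this
    linarith
  -- This makes `6kε² ≤ 3k/8`, which moves to the left side; this is where `ε ≤ 1/4` is needed.
  have h5 : ε ^ 2 ≤ 1 / 16 := by nlinarith
  nlinarith

lemma small_bias_support_bound {n s : ℕ} {ε : ℝ} (hε0 : 0 < ε) (hε : ε ≤ 1 / 4)
    (h : ∀ k : ℕ, (2 : ℝ) ^ (2 * n) ≤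
      ((s + k - 1).choose k : ℕ) * (1 + (2 : ℝ) ^ (2 * n) * (ε ^ k) ^ 2)) :
    1 / 24 * min ((2 : ℝ) ^ (2 * n)) ((n : ℝ) / (ε ^ 2 * Real.logb 2 (1 / ε))) ≤ s := by
  set L := Real.logb 2 (1 / ε) with hL
  have hL1 : 1 ≤ L := by
    rw [hL, Real.le_logb_iff_rpow_le (by norm_num) (by positivity), Real.rpow_one,
      le_div_iff₀ hε0]
    linarith
  have hεL : ε = (2 : ℝ) ^ (-L) := by
    rw [Real.rpow_neg (by norm_num), hL, Real.rpow_logb (by norm_num) (by norm_num) (by positivity)]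
    simp
  have hkey : ∀ k : ℕ, (2 : ℝ) ^ (2 * n) * (ε ^ k) ^ 2 = (2 : ℝ) ^ (2 * (n - k * L)) := by
    intro k
    rw [← pow_mul, hεL, ← Real.rpow_natCast, ← Real.rpow_natCast, ← Real.rpow_mul (by norm_num),
      ← Real.rpow_add (by norm_num)]
    congr 1; push_cast; ring
  rcases lt_or_ge (n : ℝ) L with hn | hn
  -- Here `2^{2n} ε² ≤ 1`, so `k = 1` already gives `2^{2n} ≤ 2s`.
  · have h1 := h 1
    have h2 : (2 : ℝ) ^ (2 * n) * (ε ^ 1) ^ 2 ≤ 1 := by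
      rw [hkey]
      exact Real.rpow_le_one_of_one_le_of_nonpos (by norm_num) (by push_cast; linarith)
    have h3 : (2 : ℝ) ^ (2 * n) ≤ s * 2 := by
      simp only [Nat.add_sub_cancel, Nat.choose_one_right] at h1
      refine h1.trans ?_
      gcongr; linarith
    have := min_le_left ((2 : ℝ) ^ (2 * n)) ((n : ℝ) / (ε ^ 2 * L))
    have : (0 : ℝ) ≤ s := Nat.cast_nonneg s
    linarith
  · have hL0 : 0 < L := by linarith
    -- The largest `k` with `2^{2n} ε^{2k} ≥ 1`. Since `k ≥ 1`, `n/L < k + 1 ≤ 2k`, which turns the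
    -- constant `12` into `24`.
    set k := ⌊(n : ℝ) / L⌋₊ with hk
    have hk1 : 1 ≤ k := by
      rw [hk, Nat.one_le_floor_iff]
      exact (one_le_div hL0).mpr hn
    have hkn : (k : ℝ) ≤ n / L := Nat.floor_le (by positivity)
    have hkn' : (n : ℝ) / L < k + 1 := Nat.lt_floor_add_one _
    have hk1' : (1 : ℝ) ≤ k := by exact_mod_cast hk1
    have hb := le_mul_of_choose_bound hε0 hε hk1 (by
      rw [hkey]
      refine Real.one_le_rpow (by norm_num) ?_
      have := (le_div_iff₀ hL0).mp hkn
      linarith) (h k)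
    have h2 : (n : ℝ) / L ≤ 24 * ε ^ 2 * s := by linarith
    have h3 : (n : ℝ) / (ε ^ 2 * L) ≤ 24 * s := by
      rw [mul_comm (ε ^ 2), ← div_div, div_le_iff₀ (by positivity)]
      linarith
    have := min_le_right ((2 : ℝ) ^ (2 * n)) ((n : ℝ) / (ε ^ 2 * L))
    linarith

theorem support_bound_of_isBiased {n : ℕ} (p : PMF (PauliString n)) {ε : ℝ} (h : IsBiased ε p) :
    (ε = 0 → 1 / 24 * (2 : ℝ) ^ (2 * n) ≤ (p.support.ncard : ℝ)) ∧
    (0 < ε → ε ≤ 1 / 2 →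
      1 / 24 * min ((2 : ℝ) ^ (2 * n)) ((n : ℝ) / (ε ^ 2 * Real.logb 2 (1 / ε)))
        ≤ (p.support.ncard : ℝ)) ∧
    (1 / 2 < ε → ε < 1 →
      1 / 24 * (1 - ε) * min ((2 : ℝ) ^ (2 * n)) ((n : ℝ) / (ε ^ 2 * Real.logb 2 (1 / ε)))
        ≤ (p.support.ncard : ℝ)) := by
  classical
  set S : Finset (PauliString n) := p.support.toFinset with hSdef
  have hcard : p.support.ncard = S.card := Set.ncard_eq_toFinset_card' _
  have hS : ∀ x, x ∉ S → (p x).toReal = 0 := fun x hx => by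
    have : p x = 0 := by simpa [hSdef, PMF.mem_support_iff] using hx
    simp [this]
  have hδ : ∀ u, u ≠ 0 → |fourier (fun x => (p x).toReal) u| ≤ ε := fun u hu => h u hu
  have hsum := sum_toReal_eq_one p
  have hι : Fintype.card (Fin n ⊕ Fin n) = 2 * n := by simp [two_mul]
  have hchoose := choose_mul_pow_ge hsum hS hδ
  rw [hι] at hchoose
  have hrank : ε < 1 → (2 * n : ℝ) ≤ S.card := fun h1 => by
    have := card_le_of_fourier_lt_one hsum hS fun u hu => (hδ u hu).trans_lt h1
    rw [hι] at this
    exact_mod_cast this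
  have hn : (0 : ℝ) ≤ n := Nat.cast_nonneg n
  rw [hcard]
  refine ⟨fun h0 => ?_, fun h0 h1 => ?_, fun h0 h1 => ?_⟩
  -- With `ε = 0` and `k = 1` the error term vanishes.
  · have h1 := hchoose 1
    simp [h0] at h1
    have : (0 : ℝ) < 2 ^ (2 * n) := by positivity
    linarith
  · rcases le_or_gt ε (1 / 4) with h4 | h4
    · exact small_bias_support_bound h0 h4 hchoose
    -- For `1/4 < ε ≤ 1/2` the quotient is at most `16n`, so the rank bound `2n ≤ |S|` suffices.
    · have hL : 1 ≤ Real.logb 2 (1 / ε) := by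
        rw [Real.le_logb_iff_rpow_le (by norm_num) (by positivity), Real.rpow_one,
          le_div_iff₀ h0]
        linarith
      have h2 : (n : ℝ) / (ε ^ 2 * Real.logb 2 (1 / ε)) ≤ 16 * n := by
        rw [div_le_iff₀ (by positivity)]
        have h3 : 1 / 16 ≤ ε ^ 2 := by nlinarith
        have h5 : 1 / 16 * 1 ≤ ε ^ 2 * Real.logb 2 (1 / ε) := by gcongr
        nlinarith
      have h3 := min_le_right ((2 : ℝ) ^ (2 * n)) ((n : ℝ) / (ε ^ 2 * Real.logb 2 (1 / ε)))
      have h5 := hrank (by linarith)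
      linarith
  · have hε : 0 < ε := by linarith
    -- As `ε → 1` the logarithm vanishes at least linearly in `1 - ε`; the prefactor `1 - ε`
    -- compensates, leaving at most `4n` against the rank bound.
    have hL : 1 - ε ≤ Real.logb 2 (1 / ε) := by
      have hl2 : 0 < Real.log 2 := Real.log_pos (by norm_num)
      have hl2' : Real.log 2 ≤ 1 := by linarith [Real.log_two_lt_d9]
      have hle : 1 - ε ≤ Real.log (1 / ε) := by
        rw [one_div, Real.log_inv]
        linarith [Real.log_le_sub_one_of_pos hε]
      rw [Real.logb, le_div_iff₀ hl2]
      nlinarith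
    have hε1 : 0 < 1 - ε := by linarith
    have hL0 : 0 < Real.logb 2 (1 / ε) := hε1.trans_le hL
    have h2 : (1 - ε) * ((n : ℝ) / (ε ^ 2 * Real.logb 2 (1 / ε))) ≤ 4 * n := by
      rw [← mul_div_assoc, div_le_iff₀ (by positivity)]
      have h3 : 1 / 4 ≤ ε ^ 2 := by nlinarith
      have h5 : 1 / 4 * (1 - ε) ≤ ε ^ 2 * Real.logb 2 (1 / ε) := by gcongr
      nlinarith
    have h3 : (1 - ε) * min ((2 : ℝ) ^ (2 * n)) ((n : ℝ) / (ε ^ 2 * Real.logb 2 (1 / ε))) ≤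
        (1 - ε) * ((n : ℝ) / (ε ^ 2 * Real.logb 2 (1 / ε))) :=
      mul_le_mul_of_nonneg_left (min_le_right _ _) hε1.le
    have h5 := hrank h1
    rw [mul_assoc]
    linarith

end PauliRandomization

theorem mainTheorem4 :
    (∀ (n : ℕ) (p : PMF (PauliRandomization.PauliString n)) (ε : ℝ), 0 ≤ ε →
      PauliRandomization.IsRandomizing ε (PauliRandomization.pauliMap p) →
        PauliRandomization.IsBiased ε p) ∧
    ∃ c : ℝ, 0 < c ∧
      ∀ (n : ℕ) (p : PMF (PauliRandomization.PauliString n)) (ε : ℝ), 0 ≤ ε →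
        PauliRandomization.IsRandomizing ε (PauliRandomization.pauliMap p) →
          (ε = 0 → c * (2 : ℝ) ^ (2 * n) ≤ (p.support.ncard : ℝ)) ∧
          (0 < ε → ε ≤ 1 / 2 →
            c * min ((2 : ℝ) ^ (2 * n)) ((n : ℝ) / (ε ^ 2 * Real.logb 2 (1 / ε)))
              ≤ (p.support.ncard : ℝ)) ∧
          (1 / 2 < ε → ε < 1 →
            c * (1 - ε) * min ((2 : ℝ) ^ (2 * n)) ((n : ℝ) / (ε ^ 2 * Real.logb 2 (1 / ε)))
              ≤ (p.support.ncard : ℝ)) := by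
  exact ⟨fun n p ε _ h => PauliRandomization.isBiased_of_isRandomizing p h, 1 / 24, by norm_num,
    fun n p ε _ h => PauliRandomization.support_bound_of_isBiased p
      (PauliRandomization.isBiased_of_isRandomizing p h)⟩
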